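/- Let $R$ be an associative ring with unit, and let $\mathrm{Mod}\text{-}R$ be the category of right $R$-modules. All subcategories are full and closed under isomorphism. For a subcategory $\mathscr{U}$ of $\mathrm{Mod}\text{-}R$, let $\mathrm{Sub}\,\mathscr{U}$ be the class of modules that embed in a finite direct sum of modules in $\mathscr{U}$. The subcategory $\mathscr{U}$ is called *support $\tau^-$-tilting* if it is closed under finite direct sums (including the zero module) and 1. $\mathrm{Ext}^1_R(X,U)=0$ for all $X\in\mathrm{Sub}\,\mathscr{U}$ and $U\in\mathscr{U}$; 2. for every injective module $I$ there is an exact sequence $0\to U^0\to U^1\xrightarrow{g} I$ with $U^0,U^1\in\mathscr{U}$ such that every morphism from a module in $\mathscr{U}$ to $I$ factors through $g$; 3. $\mathscr{U}$ is covariantly finite: every module $M$ has a morphism $M\to U$ with $U\in\mathscr{U}$ through which every morphism from $M$ to a module in $\mathscr{U}$ factors. Two support $\tau^-$-tilting subcategories $\mathscr{U},\mathscr{U}'$ are *equivalent* if $\mathrm{Sub}\,\mathscr{U}=\mathrm{Sub}\,\mathscr{U}'$. For a module $T$, let $\mathrm{Prod}(T)$ be the class of modules isomorphic to a direct summand of a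 direct product of (arbitrarily many) copies of $T$; let $\mathrm{Cogen}(T)$ be the class of modules that embed in a module in $\mathrm{Prod}(T)$; and let $\mathrm{Copres}(T)$ be the class of modules $X$ for which there is an exact sequence $0\to X\to T_0\to T_1$ with $T_0,T_1\in\mathrm{Prod}(T)$. The module $T$ is called *quasicotilting* if $\mathrm{Cogen}(T)=\mathrm{Copres}(T)$, the functor $\mathrm{Hom}_R(-,T)$ is exact on short exact sequences of modules in $\mathrm{Cogen}(T)$, and $\mathrm{Ext}^1_R(X,T)=0$ for all $X\in\mathrm{Cogen}(T)$. Two quasicotilting modules $T,T'$ are *equivalent* if $\mathrm{Prod}(T)=\mathrm{Prod}(T')$. **Theorem.** For every quasicotilting module $T$, the subcategory $\mathrm{Prod}(T)$ is support $\tau^-$-tilting, and there is a bijection between the equivalence classes of support $\tau^-$-tilting subcategories of $\mathrm{Mod}\text{-}R$ and the equivalence classes of quasicotilting right $R$-modules, under which the class of $\mathrm{Prod}(T)$ corresponds to the class of $T$. -/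

import Mathlib

open CategoryTheory CategoryTheory.Limits

universe w v u

namespace TauTilting

section Abelian

variable {C : Type u} [Category.{v} C]

/-- A right `U`-approximation of `A`: a morphism `f : X ⟶ A` with `X` in `U` through which every
morphism from an object of `U` to `A` factors. -/
def IsRightApproximation (U : ObjectProperty C) {X A : C} (f : X ⟶ A) : Prop :=
  U X ∧ ∀ ⦃X' : C⦄, U X' → ∀ g : X' ⟶ A, ∃ h : X' ⟶ X, h ≫ f = g

/-- A left `U`-approximation of `A`: a morphism `f : A ⟶ X` with `X` in `U` through which every
morphism from `A` to an object of `U` factors. -/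
def IsLeftApproximation (U : ObjectProperty C) {A X : C} (f : A ⟶ X) : Prop :=
  U X ∧ ∀ ⦃X' : C⦄, U X' → ∀ g : A ⟶ X', ∃ h : X ⟶ X', f ≫ h = g

/-- Every object admits a left `U`-approximation. -/
def IsCovariantlyFinite (U : ObjectProperty C) : Prop :=
  ∀ A : C, ∃ (X : C) (f : A ⟶ X), IsLeftApproximation U f

variable [Abelian C]

attribute [local instance] Abelian.hasFiniteBiproducts

/-- `Sub U`: the subobjects of finite direct sums of objects of `U`. -/
def Sub (U : ObjectProperty C) : ObjectProperty C := fun A =>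
  ∃ (n : ℕ) (V : Fin n → C) (i : A ⟶ ⨁ V), (∀ k, U (V k)) ∧ Mono i

/-- Support `τ⁻`-tilting subcategories of an abelian category (with enough injectives). A full
subcategory is given by its class of objects. It is additive when it is closed under finite direct
sums, i.e. under finite products; this includes the zero object and closure under isomorphism. -/
structure IsSupportTauMinusTilting [HasExt.{w} C] (U : ObjectProperty C) : Prop where
  additive : U.IsClosedUnderFiniteProducts
  ext_eq_zero : ∀ A V : C, Sub U A → U V → Subsingleton (Abelian.Ext.{w} A V 1)
  exists_exact : ∀ I : C, Injective I →
    ∃ (U₀ U₁ : C) (f : U₀ ⟶ U₁) (g : U₁ ⟶ I) (zero : f ≫ g = 0),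
      U U₀ ∧ U U₁ ∧ Mono f ∧ (ShortComplex.mk f g zero).Exact ∧ IsRightApproximation U g
  covariantlyFinite : IsCovariantlyFinite U

end Abelian

section Modules

/-- The category `Mod-R` of right `R`-modules. -/
abbrev ModR (R : Type u) [Ring R] : Type (u + 1) := ModuleCat.{u} Rᵐᵒᵖ

variable {R : Type u} [Ring R]

/-- `Prod M`: the modules isomorphic to a direct summand of a direct product of copies of `M`. -/
def Prod (M : ModR R) : ObjectProperty (ModR R) := fun X =>
  ∃ J : Type u, Nonempty (Retract X (∏ᶜ fun _ : J => M))

/-- `Cogen M`: the modules isomorphic to a submodule of a module in `Prod M`. -/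
def Cogen (M : ModR R) : ObjectProperty (ModR R) := fun X =>
  ∃ (Y : ModR R) (i : X ⟶ Y), Prod M Y ∧ Mono i

/-- `Copres M`: the modules `X` with an exact sequence `0 ⟶ X ⟶ M₀ ⟶ M₁`, where `M₀` and `M₁` are
in `Prod M`. -/
def Copres (M : ModR R) : ObjectProperty (ModR R) := fun X =>
  ∃ (M₀ M₁ : ModR R) (f : X ⟶ M₀) (g : M₀ ⟶ M₁) (zero : f ≫ g = 0),
    Prod M M₀ ∧ Prod M M₁ ∧ Mono f ∧ (ShortComplex.mk f g zero).Exact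

/-- Quasicotilting modules. -/
structure IsQuasicotilting (T : ModR R) : Prop where
  cogen_eq_copres : Cogen T = Copres T
  hom_exact : ∀ S : ShortComplex (ModR R), S.ShortExact →
    Cogen T S.X₁ → Cogen T S.X₂ → Cogen T S.X₃ →
      (S.op.map (preadditiveYoneda.obj T)).ShortExact
  ext_injective : ∀ X : ModR R, Cogen T X → Subsingleton (Abelian.Ext.{u} X T 1)

variable (R)

/-- The support `τ⁻`-tilting subcategories of `Mod-R`. -/
def SupportTauMinusTilting : Type (u + 1) :=
  {U : ObjectProperty (ModR R) // IsSupportTauMinusTilting.{u} U}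

/-- The quasicotilting right `R`-modules. -/
def Quasicotilting : Type (u + 1) :=
  {T : ModR R // IsQuasicotilting T}

/-- Two support `τ⁻`-tilting subcategories `U`, `U'` are equivalent if `Sub U = Sub U'`. -/
instance supportTauMinusTiltingSetoid : Setoid (SupportTauMinusTilting R) where
  r U U' := Sub U.1 = Sub U'.1
  iseqv := ⟨fun _ => rfl, fun h => h.symm, fun h h' => h.trans h'⟩

/-- Two quasicotilting modules `T`, `T'` are equivalent if `Prod T = Prod T'`. -/
instance quasicotiltingSetoid : Setoid (Quasicotilting R) where
  r T T' := Prod T.1 = Prod T'.1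
  iseqv := ⟨fun _ => rfl, fun h => h.symm, fun h h' => h.trans h'⟩

end Modules

end TauTilting

/-! For quasicotilting `T`, `Prod T` is the class of `Ext`-injectives of `Cogen T`, and `Sub (Prod
T) = Cogen T`. So `Cogen T` and `Prod T` determine each other, and `T ↦ Prod T` is injective on
classes (`prod_iff`, `sub_prod`). For surjectivity, let `0 → U₀ → U₁ → E` be the approximation
sequence of an injective cogenerator `E`; then `U₀ ⊞ U₁` is quasicotilting and cogenerates exactly
`Sub U`.

The hard point is that `Prod T` has right approximations of injectives. This follows once the class
of modules cogenerated by `T` is precovering (`exists_precover`), which needs a bound on the sources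
to be considered.

The bound rests on one fact: for a nonempty well-order `J` without maximum, `T ^ J` modulo families
of bounded support is cogenerated by `T`. It comes from a counting argument on a tree whose labels
encode maps, so that a failed lift would inject the sets of branches into the branches, against
Cantor. Eventually linear families of maps to `T` then have limits (`exists_limit`). Hence
dependence through maps to `T` is witnessed finitely, and kernels of cogenerated quotients are
closed under unions of chains. Zorn's lemma reduces any map to `M` to a minimal quotient of its
source, whose elements are encoded by functions from a fixed set to `M`. -/

namespace TauTilting

/-! ### Modules cogenerated by `T`. -/

section Elementary

variable {S : Type u} [Ring S]

/-- The points of `M` are separated by linear maps to `T`; equivalently, `M` embeds in a power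
of `T`. -/
def IsCogeneratedBy (S : Type u) [Ring S] (T M : Type u) [AddCommGroup T] [Module S T]
    [AddCommGroup M] [Module S M] : Prop :=
  ∀ m : M, m ≠ 0 → ∃ f : M →ₗ[S] T, f m ≠ 0

variable {T : Type u} [AddCommGroup T] [Module S T]
variable {M N : Type u} [AddCommGroup M] [Module S M] [AddCommGroup N] [Module S N]

namespace IsCogeneratedBy

theorem refl : IsCogeneratedBy S T T := fun _ hm => ⟨LinearMap.id, hm⟩

theorem of_separating {ι : Type*} {N : ι → Type u} [∀ i, AddCommGroup (N i)]
    [∀ i, Module S (N i)] (h : ∀ i, IsCogeneratedBy S T (N i))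
    (hM : ∀ m : M, m ≠ 0 → ∃ (i : ι) (f : M →ₗ[S] N i), f m ≠ 0) : IsCogeneratedBy S T M := by
  intro m hm
  obtain ⟨i, f, hf⟩ := hM m hm
  obtain ⟨g, hg⟩ := h i (f m) hf
  exact ⟨g ∘ₗ f, hg⟩

theorem of_injective (h : IsCogeneratedBy S T N) (f : M →ₗ[S] N) (hf : Function.Injective f) :
    IsCogeneratedBy S T M :=
  of_separating (fun _ : Unit => h) fun m hm => ⟨(), f, by rwa [Ne, map_eq_zero_iff f hf]⟩

theorem submodule (h : IsCogeneratedBy S T M) (P : Submodule S M) : IsCogeneratedBy S T P :=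
  h.of_injective P.subtype P.injective_subtype

theorem pi {ι : Type u} {N : ι → Type u} [∀ i, AddCommGroup (N i)]
    [∀ i, Module S (N i)] (h : ∀ i, IsCogeneratedBy S T (N i)) :
    IsCogeneratedBy S T (∀ i, N i) :=
  of_separating h fun m hm => by
    obtain ⟨i, hi⟩ := Function.ne_iff.mp hm
    exact ⟨i, LinearMap.proj i, hi⟩

theorem quotient_iff {P : Submodule S M} : IsCogeneratedBy S T (M ⧸ P) ↔
    ∀ m, m ∉ P → ∃ f : M →ₗ[S] T, P ≤ LinearMap.ker f ∧ f m ≠ 0 := by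
  constructor
  · intro h m hm
    obtain ⟨f, hf⟩ := h (P.mkQ m) (by simpa using hm)
    exact ⟨f ∘ₗ P.mkQ, fun x hx => by simp [(Submodule.Quotient.mk_eq_zero P).mpr hx], hf⟩
  · intro h m hm
    obtain ⟨m, rfl⟩ := P.mkQ_surjective m
    obtain ⟨f, hP, hf⟩ := h m (by simpa using hm)
    exact ⟨P.liftQ f hP, by simpa using hf⟩

end IsCogeneratedBy

/-! ### Bounded support, trees of labels and Cantor's theorem. -/

section BoundedSupport

variable (S T) (J : Type u) [LinearOrder J] [Nonempty J]

/-- The families vanishing from some index on. -/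
def boundedSupport : Submodule S (J → T) where
  carrier := {x | ∃ j, ∀ k, j ≤ k → x k = 0}
  zero_mem' := ⟨Classical.arbitrary J, fun _ _ => rfl⟩
  add_mem' := by
    rintro x y ⟨i, hi⟩ ⟨j, hj⟩
    exact ⟨max i j, fun k hk => by
      simp [hi k (le_of_max_le_left hk), hj k (le_of_max_le_right hk)]⟩
  smul_mem' := by
    rintro c x ⟨i, hi⟩
    exact ⟨i, fun k hk => by simp [hi k hk]⟩

end BoundedSupport

/-- A recursive choice of label sets along a well-order. -/
theorem exists_labels (J X E : Type u) [LinearOrder J] [WellFoundedLT J] :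
    ∃ L : J → Type u, ∀ j, Nonempty (L j ≃ ((∀ k : Set.Iio j, L k × X) → E)) := by
  let L : J → Type u := (wellFounded_lt (α := J)).fix
    fun j rec => (∀ k : Set.Iio j, rec k k.2 × X) → E
  refine ⟨L, fun j => ⟨Equiv.cast ?_⟩⟩
  exact (wellFounded_lt (α := J)).fix_eq _ j

section Tree

variable {J : Type u} [LinearOrder J] (L : J → Type u)

open Classical in
/-- The family over the nodes of the tree of labels which is supported on the branch `b`, where it
is given by `x`. -/
noncomputable def branch (b : ∀ j, L j) :
    (J → T) →ₗ[S] (∀ k : J, (∀ i : Set.Iio k, L i) → T) :=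
  LinearMap.pi fun k => LinearMap.pi fun s => if s = (fun i : Set.Iio k => b i.1) then LinearMap.proj k else 0

open Classical in
/-- The family over the nodes of the tree of labels supported on a bounded piece of a branch. -/
noncomputable def branchPiece (j : J) (t : ∀ k : Set.Iio j, L k × T) :
    ∀ k : J, (∀ i : Set.Iio k, L i) → T :=
  fun k s => if h : k < j then
    if s = (fun i : Set.Iio k => (t ⟨i.1, lt_trans i.2 h⟩).1) then (t ⟨k, h⟩).2 else 0 else 0

open Classical in
theorem branch_apply (b : ∀ j, L j) (x : J → T) (k : J) (s : ∀ i : Set.Iio k, L i) :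
    branch (S := S) L b x k s = if s = (fun i : Set.Iio k => b i.1) then x k else 0 := by
  simp only [branch, LinearMap.pi_apply]
  split_ifs <;> simp

/-- Only the labels and values below `j` matter, so restricting a map to such families gives a
function on exactly the data that a label in `L j` encodes. -/
theorem branch_eq_branchPiece (b : ∀ j, L j) (x : J → T) (j : J) (hx : ∀ k, j ≤ k → x k = 0) :
    branch (S := S) L b x = branchPiece L j fun k => (b k, x k) := by
  classical
  funext k s
  rw [branch_apply, branchPiece]
  by_cases h : k < j
  · simp [h]
  · simp [h, hx k (not_lt.mp h)]

variable [Nonempty J] [NoMaxOrder J]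

/-- Distinct branches are independent modulo bounded support. -/
theorem mem_boundedSupport_of_sum_branch_eq_zero (w : (∀ j, L j) →₀ (J → T))
    (hw : (w.sum fun b x => branch (S := S) L b x) = 0) (b : ∀ j, L j) :
    w b ∈ boundedSupport S T J := by
  classical
  have h1 : ∀ b' : ∀ j, L j, ∃ i, b' ≠ b → b' i ≠ b i := by
    intro b'
    by_cases h : b' = b
    · exact ⟨Classical.arbitrary J, fun h' => (h' h).elim⟩
    · obtain ⟨i, hi⟩ := Function.ne_iff.mp h
      exact ⟨i, fun _ => hi⟩
  choose d hd using h1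
  obtain ⟨j, hj⟩ := (w.support.image d).exists_le
  obtain ⟨j', hj'⟩ := exists_gt j
  refine ⟨j', fun k hk => ?_⟩
  -- At level `k` the finitely many other branches in the support have already left `b`, so the node
  -- of `b` sees only `w b`.
  have h2 := congrFun (congrFun hw k) (fun i : Set.Iio k => b i.1)
  rw [Finsupp.sum, Finset.sum_apply, Finset.sum_apply, Finset.sum_eq_single b] at h2
  · simpa [branch_apply] using h2
  · intro b' hb' hne
    rw [branch_apply, if_neg]
    intro h
    have hlt : d b' < k := ((hj _ (Finset.mem_image_of_mem d hb')).trans_lt hj').trans_le hk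
    exact hd b' hne (congrFun h ⟨d b', hlt⟩).symm
  · intro hb
    simp [Finsupp.notMem_support_iff.mp hb]

end Tree

/-- `σ` descends to the range of `p`, which is cogenerated by `T`; the descended map lifts to `E`,
and injectivity extends the lift to `V`. -/
theorem exists_extension_of_lift {P V E C : Type u} [AddCommGroup P] [Module S P]
    [AddCommGroup V] [Module S V] [AddCommGroup E] [Module S E] [AddCommGroup C] [Module S C]
    {q : E →ₗ[S] C} (hE : Module.Injective S E)
    (hlift : ∀ (A : Type u) [AddCommGroup A] [Module S A], IsCogeneratedBy S T A →
      ∀ ρ : A →ₗ[S] C, ∃ ψ : A →ₗ[S] E, q ∘ₗ ψ = ρ)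
    (hV : IsCogeneratedBy S T V) (p : P →ₗ[S] V) (σ : P →ₗ[S] C)
    (hσ : LinearMap.ker p ≤ LinearMap.ker σ) :
    ∃ Ψ : V →ₗ[S] E, ∀ w, q (Ψ (p w)) = σ w := by
  obtain ⟨ψ, hψ⟩ := hlift _ (hV.submodule (LinearMap.range p))
    ((LinearMap.ker p).liftQ σ hσ ∘ₗ p.quotKerEquivRange.symm.toLinearMap)
  obtain ⟨Ψ, h⟩ := hE.out (LinearMap.range p).subtype (Submodule.injective_subtype _) ψ
  refine ⟨Ψ, fun w => ?_⟩
  have h1 := h ⟨p w, w, rfl⟩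
  have h2 := LinearMap.congr_fun hψ ⟨p w, w, rfl⟩
  have h3 : p.quotKerEquivRange.symm ⟨p w, w, rfl⟩ = (LinearMap.ker p).mkQ w := by
    rw [LinearEquiv.symm_apply_eq]; rfl
  simp only [Submodule.subtype_apply] at h1
  rw [h1]
  simpa [h3] using h2

/-- Cantor's theorem on the set of branches of a tree of labels forces maps which vanish on
families of bounded support to lift. -/
theorem exists_lift_vanishing_on_boundedSupport {J : Type u} [LinearOrder J] [WellFoundedLT J]
    [Nonempty J] [NoMaxOrder J] {E C : Type u} [AddCommGroup E] [Module S E] [AddCommGroup C]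
    [Module S C] (q : E →ₗ[S] C) (hE : Module.Injective S E)
    (hlift : ∀ (A : Type u) [AddCommGroup A] [Module S A], IsCogeneratedBy S T A →
      ∀ ρ : A →ₗ[S] C, ∃ ψ : A →ₗ[S] E, q ∘ₗ ψ = ρ)
    (Z : Submodule S (J → T)) (ρ : Z →ₗ[S] C)
    (hρ : ∀ z : Z, z.1 ∈ boundedSupport S T J → ρ z = 0) :
    ∃ σ : Z →ₗ[S] E, q ∘ₗ σ = ρ ∧ ∀ z : Z, z.1 ∈ boundedSupport S T J → σ z = 0 := by
  classical
  by_contra hcon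
  obtain ⟨L, hL⟩ := exists_labels J T E
  let e := fun j => (hL j).some
  let p : ((∀ j, L j) →₀ Z) →ₗ[S] (∀ k : J, (∀ i : Set.Iio k, L i) → T) :=
    Finsupp.lsum ℕ fun b => branch L b ∘ₗ Z.subtype
  have hp : ∀ w ∈ LinearMap.ker p, ∀ b, (w b).1 ∈ boundedSupport S T J := by
    intro w hw b
    have := mem_boundedSupport_of_sum_branch_eq_zero (S := S) L
      (w.mapRange Z.subtype (map_zero _)) (by
        rw [Finsupp.sum_mapRange_index (by simp)]
        rw [LinearMap.mem_ker, Finsupp.lsum_apply] at hw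
        exact hw) b
    simpa using this
  -- Use `ρ` on the branches in `B` and zero on the others. This factors through `p`, since elements
  -- of its kernel have components of bounded support, where `ρ` vanishes.
  let σ (B : Set (∀ j, L j)) : ((∀ j, L j) →₀ Z) →ₗ[S] C :=
    Finsupp.lsum ℕ fun b => if b ∈ B then ρ else 0
  have hσ : ∀ B, LinearMap.ker p ≤ LinearMap.ker (σ B) := by
    intro B w hw
    rw [LinearMap.mem_ker, Finsupp.lsum_apply]
    refine Finset.sum_eq_zero fun b _ => ?_
    dsimp only
    split_ifs
    · exact hρ _ (hp w hw b)
    · simp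
  have hp1 : ∀ b z, p (Finsupp.single b z) = branch (S := S) L b z.1 := fun b z => by
    simp [p]
  have hσ1 : ∀ B b z, σ B (Finsupp.single b z) = if b ∈ B then ρ z else 0 := fun B b z => by
    simp only [σ, Finsupp.lsum_single]; split_ifs <;> rfl
  clear_value p σ
  have hΨ : ∀ B, ∃ Ψ : (∀ k : J, (∀ i : Set.Iio k, L i) → T) →ₗ[S] E, ∀ w, q (Ψ (p w)) = σ B w := by
    intro B
    have hV (k : J) : IsCogeneratedBy S T ((∀ i : Set.Iio k, L i) → T) :=
      .pi fun _ => .refl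
    have hV' : IsCogeneratedBy S T (∀ k : J, (∀ i : Set.Iio k, L i) → T) := .pi hV
    exact exists_extension_of_lift (P := (∀ j, L j) →₀ Z) hE hlift hV' p (σ B) (hσ B)
  choose Ψ hΨ using hΨ
  -- By the choice of `L`, the values of `Ψ B` on bounded pieces form a branch themselves.
  refine Function.cantor_injective
    (fun B j => (e j).symm fun t => Ψ B (branchPiece L j t)) fun B B' hBB => ?_
  have key : ∀ B B' : Set (∀ j, L j),
      (∀ j, ((e j).symm fun t => Ψ B (branchPiece L j t)) =
        (e j).symm fun t => Ψ B' (branchPiece L j t)) → B ⊆ B' := by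
    intro B B' h b hb
    by_contra hb'
    -- Along `b`, in `B` but not in `B'`, the difference lifts `ρ`; equality of the codes makes it
    -- vanish on bounded support.
    refine hcon ⟨(Ψ B - Ψ B') ∘ₗ branch L b ∘ₗ Z.subtype, ?_, ?_⟩
    · ext z
      have hz : branch (S := S) L b z.1 = p (Finsupp.single b z) := (hp1 b z).symm
      have h1 := hΨ B (Finsupp.single b z)
      have h2 := hΨ B' (Finsupp.single b z)
      simp only [hσ1, hb, hb', if_true, if_false] at h1 h2
      simp [hz, h1, h2]
    · rintro z ⟨j, hj⟩
      have h1 := congrFun ((e j).symm.injective (h j)) fun k => (b k, z.1 k)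
      simp only [LinearMap.comp_apply, Submodule.subtype_apply, LinearMap.sub_apply,
        branch_eq_branchPiece L b z.1 j hj]
      exact sub_eq_zero.mpr h1
  exact Set.Subset.antisymm (key B B' (congrFun hBB)) (key B' B fun j => (congrFun hBB j).symm)

end Elementary

/-! ### Powers modulo bounded support, and limits of maps. -/

section Elementary

variable {S : Type u} [Ring S]
variable {T : Type u} [AddCommGroup T] [Module S T]
variable {M : Type u} [AddCommGroup M] [Module S M]

/-- Maps to `T` extend along inclusions with quotient cogenerated by `T`, and every module
cogenerated by `T` embeds in a power of `T` with quotient cogenerated by `T`. -/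
structure HasCotiltingExtensions (S T : Type u) [Ring S] [AddCommGroup T] [Module S T] :
    Prop where
  exists_extension : ∀ (N : Type u) [AddCommGroup N] [Module S N] (K : Submodule S N),
    IsCogeneratedBy S T (N ⧸ K) → ∀ f : K →ₗ[S] T, ∃ g : N →ₗ[S] T, ∀ x : K, g x = f x
  exists_embedding : ∀ (N : Type u) [AddCommGroup N] [Module S N], IsCogeneratedBy S T N →
    ∃ (J : Type u) (i : N →ₗ[S] (J → T)), Function.Injective i ∧
      IsCogeneratedBy S T ((J → T) ⧸ LinearMap.range i)

namespace HasCotiltingExtensions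

variable (h : HasCotiltingExtensions S T)
include h

/-- Maps to a quotient `C` of an injective module by `T` lift along the quotient map. -/
theorem exists_lift {E C : Type u} [AddCommGroup E] [Module S E] [AddCommGroup C] [Module S C]
    (j : T →ₗ[S] E) (hj : Function.Injective j) (q : E →ₗ[S] C) (hq : Function.Surjective q)
    (hjq : LinearMap.range j = LinearMap.ker q)
    (A : Type u) [AddCommGroup A] [Module S A] (hA : IsCogeneratedBy S T A) (ρ : A →ₗ[S] C) :
    ∃ ψ : A →ₗ[S] E, q ∘ₗ ψ = ρ := by
  -- The pullback of `ρ` and `q` is an extension of `A` by `T`. Extending the identification of its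
  -- kernel with `T` splits it, and the corrected second projection descends to `A`.
  let N : Submodule S (A × E) :=
    LinearMap.ker (ρ ∘ₗ LinearMap.fst S A E - q ∘ₗ LinearMap.snd S A E)
  have hN : ∀ x : A × E, x ∈ N ↔ ρ x.1 = q x.2 := fun x => by simp [N, sub_eq_zero]
  let π : N →ₗ[S] A := LinearMap.fst S A E ∘ₗ N.subtype
  let K : Submodule S N := LinearMap.ker π
  have hK : IsCogeneratedBy S T (N ⧸ K) :=
    hA.of_injective (K.liftQ π le_rfl) (LinearMap.ker_eq_bot.mp (Submodule.ker_liftQ_eq_bot' K π rfl))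
  have hK2 : ∀ x : K, (x.1.1.2 : E) ∈ LinearMap.range j := by
    rintro ⟨⟨⟨a, e⟩, hx⟩, hx'⟩
    rw [hN] at hx
    have : a = 0 := hx'
    subst this
    rw [hjq, LinearMap.mem_ker]
    simpa using hx.symm
  let je := LinearEquiv.ofInjective j hj
  let f : K →ₗ[S] T := je.symm.toLinearMap ∘ₗ
    ((LinearMap.snd S A E ∘ₗ N.subtype ∘ₗ K.subtype).codRestrict (LinearMap.range j) hK2)
  obtain ⟨g, hg⟩ := h.exists_extension N K hK f
  have hf : ∀ x : K, j (f x) = x.1.1.2 := fun x => by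
    have : je (f x) = ⟨x.1.1.2, hK2 x⟩ := by simp [f]; rfl
    simpa [je] using congrArg Subtype.val this
  have hπ : Function.Surjective π := fun a => by
    obtain ⟨e, he⟩ := hq (ρ a)
    exact ⟨⟨(a, e), (hN _).2 he.symm⟩, rfl⟩
  let τ : N →ₗ[S] E := LinearMap.snd S A E ∘ₗ N.subtype - j ∘ₗ g
  have hτ : LinearMap.ker π ≤ LinearMap.ker τ := fun x hx => by
    have h1 := hg ⟨x, hx⟩
    have h2 := hf ⟨x, hx⟩
    simp only [← h1] at h2
    simp [τ, h2]
  refine ⟨(LinearMap.ker π).liftQ τ hτ ∘ₗ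
    (π.quotKerEquivOfSurjective hπ).symm.toLinearMap, ?_⟩
  ext a
  obtain ⟨x, rfl⟩ := hπ a
  have h1 : (π.quotKerEquivOfSurjective hπ).symm (π x) = (LinearMap.ker π).mkQ x := by
    rw [LinearEquiv.symm_apply_eq]; rfl
  have h2 : q (j (g x)) = 0 := by
    rw [← LinearMap.mem_ker, ← hjq]; exact ⟨_, rfl⟩
  have h3 := (hN x.1).1 x.2
  simp only [LinearMap.comp_apply, LinearEquiv.coe_coe, h1, Submodule.mkQ_apply,
    Submodule.liftQ_apply]
  simp [τ, h2, π, h3]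

/-- Maps to `T` extend from families of bounded support. -/
theorem exists_extension_boundedSupport {J : Type u} [LinearOrder J] [WellFoundedLT J]
    [Nonempty J] [NoMaxOrder J] (Z : Submodule S (J → T)) (hZ : boundedSupport S T J ≤ Z)
    (f : boundedSupport S T J →ₗ[S] T) :
    ∃ g : Z →ₗ[S] T, ∀ x (hx : x ∈ boundedSupport S T J), g ⟨x, hZ hx⟩ = f ⟨x, hx⟩ := by
  obtain ⟨E, _, _, hE, j, hj⟩ : ∃ (E : Type u) (_ : AddCommGroup E) (_ : Module S E)
      (_ : Module.Injective S E) (j : T →ₗ[S] E), Function.Injective j := by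
    let E : ModuleCat.{u} S := Injective.under (ModuleCat.of S T)
    let j : ModuleCat.of S T ⟶ E := Injective.ι _
    have hE : Injective E := inferInstanceAs (Injective (Injective.under _))
    have hj : Mono j := inferInstanceAs (Mono (Injective.ι _))
    exact ⟨E, inferInstance, inferInstance, (Module.injective_iff_injective_object S E).2 hE,
      j.hom, (ModuleCat.mono_iff_injective _).mp hj⟩
  let q := (LinearMap.range j).mkQ
  have hq : Function.Surjective q := (LinearMap.range j).mkQ_surjective
  have hjq : LinearMap.range j = LinearMap.ker q := (Submodule.ker_mkQ _).symm
  obtain ⟨F, hF⟩ := hE.out (boundedSupport S T J).subtype (Submodule.injective_subtype _) (j ∘ₗ f)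
  have hF' : ∀ x (hx : x ∈ boundedSupport S T J), F x = j (f ⟨x, hx⟩) := fun x hx => hF ⟨x, hx⟩
  have hqj : ∀ t, q (j t) = 0 := fun t => by
    rw [← LinearMap.mem_ker, ← hjq]; exact ⟨_, rfl⟩
  -- Subtracting `σ` from `F` brings the values into the image of `j` without changing them on
  -- bounded support.
  obtain ⟨σ, hσ, hσ'⟩ := exists_lift_vanishing_on_boundedSupport q hE
    (h.exists_lift j hj q hq hjq) Z (q ∘ₗ F ∘ₗ Z.subtype) (fun z hz => by
      simp [hF' z.1 hz, hqj])
  have hr : ∀ z, (F ∘ₗ Z.subtype - σ) z ∈ LinearMap.range j := fun z => by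
    rw [hjq, LinearMap.mem_ker, LinearMap.sub_apply, map_sub, sub_eq_zero]
    exact (LinearMap.congr_fun hσ z).symm
  let je := LinearEquiv.ofInjective j hj
  refine ⟨je.symm.toLinearMap ∘ₗ (F ∘ₗ Z.subtype - σ).codRestrict (LinearMap.range j) hr,
    fun x hx => ?_⟩
  rw [LinearMap.comp_apply, LinearEquiv.coe_coe, LinearEquiv.symm_apply_eq]
  apply Subtype.ext
  simp [je, hF' x hx, hσ' ⟨x, hZ hx⟩ hx]

/-- The power of `T` over a well-order without maximum, modulo families of bounded support, is
cogenerated by `T`. -/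
theorem isCogeneratedBy_quotient_boundedSupport (J : Type u) [LinearOrder J] [WellFoundedLT J]
    [Nonempty J] [NoMaxOrder J] : IsCogeneratedBy S T ((J → T) ⧸ boundedSupport S T J) := by
  let B := boundedSupport S T J
  -- `Z` is the least submodule above `B` with quotient cogenerated by `T`; the aim is `Z = B`.
  let Z : Submodule S (J → T) :=
    ⨅ f : {f : (J → T) →ₗ[S] T // B ≤ LinearMap.ker f}, LinearMap.ker f.1
  have hmem : ∀ x, x ∈ Z ↔ ∀ f : (J → T) →ₗ[S] T, B ≤ LinearMap.ker f → f x = 0 := by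
    simp [Z]
  have hBZ : B ≤ Z := fun x hx => (hmem x).2 fun f hf => hf hx
  have hQ : IsCogeneratedBy S T ((J → T) ⧸ Z) := IsCogeneratedBy.quotient_iff.2 fun m hm => by
    rw [hmem] at hm
    push Not at hm
    obtain ⟨f, hf, hfm⟩ := hm
    exact ⟨f, fun x hx => (hmem x).1 hx f hf, hfm⟩
  have hpow : IsCogeneratedBy S T (J → T) := .pi fun _ => .refl
  have hzero : ∀ f : Z →ₗ[S] T, (∀ x (hx : x ∈ B), f ⟨x, hBZ hx⟩ = 0) → f = 0 := by
    intro f hf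
    obtain ⟨g, hg⟩ := h.exists_extension _ Z hQ f
    ext z
    rw [← hg z]
    exact (hmem z).1 z.2 g fun x hx => (hg ⟨x, hBZ hx⟩).trans (hf x hx)
  obtain ⟨J', i, hi, hcok⟩ := h.exists_embedding B (hpow.submodule B)
  choose g hg using fun k : J' => h.exists_extension_boundedSupport Z hBZ (LinearMap.proj k ∘ₗ i)
  let I : Z →ₗ[S] (J' → T) := LinearMap.pi g
  have hI : ∀ x (hx : x ∈ B), I ⟨x, hBZ hx⟩ = i ⟨x, hx⟩ := fun x hx => funext fun k => hg k x hx
  -- Every map from `Z` to `T` factors through `I`: extend its restriction to `B` along `i`, and use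
  -- that maps on `Z` agreeing on `B` are equal.
  have hIinj : ∀ w, I w = 0 → w = 0 := by
    intro w hw
    by_contra hne
    obtain ⟨f, hf⟩ := hpow.submodule Z w hne
    let ie := LinearEquiv.ofInjective i hi
    obtain ⟨f', hf'⟩ := h.exists_extension _ (LinearMap.range i) hcok
      ((f ∘ₗ Submodule.inclusion hBZ) ∘ₗ ie.symm.toLinearMap)
    have h0 := hzero (f' ∘ₗ I - f) fun x hx => by
      have h1 := hf' (ie ⟨x, hx⟩)
      simp only [LinearMap.comp_apply, LinearEquiv.coe_coe, LinearEquiv.symm_apply_apply] at h1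
      simp only [LinearMap.sub_apply, LinearMap.comp_apply, hI x hx]
      exact sub_eq_zero.2 h1
    have h1 := LinearMap.congr_fun h0 w
    simp [hw] at h1
    exact hf h1
  have hZB : Z ≤ B := by
    intro z hz
    by_contra hzB
    have hne : I ⟨z, hz⟩ ∉ LinearMap.range i := by
      rintro ⟨b, hb⟩
      have h1 := hIinj (⟨z, hz⟩ - ⟨b.1, hBZ b.2⟩) (by rw [map_sub, hI b.1 b.2, hb, sub_self])
      rw [sub_eq_zero] at h1
      have h2 : z = b.1 := congrArg Subtype.val h1
      exact hzB (h2 ▸ b.2)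
    obtain ⟨f, hf, hfz⟩ := IsCogeneratedBy.quotient_iff.1 hcok _ hne
    refine hfz (LinearMap.congr_fun (hzero (f ∘ₗ I) fun x hx => ?_) ⟨z, hz⟩)
    exact hf ⟨_, (hI x hx).symm⟩
  rwa [le_antisymm hZB hBZ] at hQ

/-- A family of maps to `T`, each element of which is eventually linear, has a linear limit. -/
theorem exists_limit (J : Type u) [LinearOrder J] [WellFoundedLT J]
    [Nonempty J] [NoMaxOrder J] (g : J → M → T)
    (hadd : ∀ a b, ∃ j, ∀ k, j ≤ k → g k (a + b) = g k a + g k b)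
    (hsmul : ∀ (c : S) a, ∃ j, ∀ k, j ≤ k → g k (c • a) = c • g k a)
    (y : M) (hy : ∀ j, g j y ≠ 0) :
    ∃ G : M →ₗ[S] T, G y ≠ 0 ∧ ∀ x, (∃ j, ∀ k, j ≤ k → g k x = 0) → G x = 0 := by
  let B := boundedSupport S T J
  let Γ : M →ₗ[S] ((J → T) ⧸ B) :=
    { toFun := fun m => B.mkQ fun j => g j m
      map_add' := fun a b => by
        rw [← map_add, ← sub_eq_zero, ← map_sub]
        obtain ⟨j, hj⟩ := hadd a b
        exact (Submodule.Quotient.mk_eq_zero B).2 ⟨j, fun k hk => by simp [hj k hk]⟩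
      map_smul' := fun c a => by
        rw [RingHom.id_apply, ← map_smul, ← sub_eq_zero, ← map_sub]
        obtain ⟨j, hj⟩ := hsmul c a
        exact (Submodule.Quotient.mk_eq_zero B).2 ⟨j, fun k hk => by simp [hj k hk]⟩ }
  have hΓ : ∀ x, Γ x = 0 ↔ ∃ j, ∀ k, j ≤ k → g k x = 0 := fun x =>
    Submodule.Quotient.mk_eq_zero B
  obtain ⟨f, hf⟩ := h.isCogeneratedBy_quotient_boundedSupport J (Γ y) (by
    rw [Ne, hΓ]
    rintro ⟨j, hj⟩
    exact hy j (hj j le_rfl))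
  exact ⟨f ∘ₗ Γ, hf, fun x hx => by rw [LinearMap.comp_apply, (hΓ x).2 hx, map_zero]⟩

end HasCotiltingExtensions

end Elementary

/-! ### Finite witnesses of dependence, and precovers. -/

section Elementary

variable {S : Type u} [Ring S]
variable {T : Type u} [AddCommGroup T] [Module S T]
variable {M : Type u} [AddCommGroup M] [Module S M]

/-- Every map from the submodule `P` to `T` which kills `x` kills `y`. -/
def IsDependentIn (T : Type u) [AddCommGroup T] [Module S T] (x y : M) (P : Submodule S M) :
    Prop :=
  ∀ (f : P →ₗ[S] T) (hx : x ∈ P) (hy : y ∈ P), f ⟨x, hx⟩ = 0 → f ⟨y, hy⟩ = 0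

/-- A chain has a well-ordered cofinal subset. -/
theorem exists_wellFounded_cofinal {α : Type*} [LinearOrder α] :
    ∃ A : Set α, WellFoundedLT A ∧ ∀ a, ∃ b ∈ A, a ≤ b := by
  let r : α → α → Prop := WellOrderingRel
  have hr : WellFounded r := IsWellFounded.wf
  -- These are the records of an auxiliary well-order `r`: on them `<` implies `r`, and the
  -- `r`-least element above `a` is a record.
  refine ⟨{a | ∀ b, r b a → b < a}, ⟨?_⟩, fun a => ?_⟩
  · refine Subrelation.wf (r := InvImage r Subtype.val) ?_ (InvImage.wf _ hr)
    intro a b hab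
    rcases trichotomous_of r a.1 b.1 with h | h | h
    · exact h
    · exact absurd h (ne_of_lt hab)
    · exact absurd (a.2 b.1 h) (not_lt.2 (le_of_lt hab))
  · obtain ⟨m, hm, hmin⟩ := hr.has_min {b | a ≤ b} ⟨a, le_refl a⟩
    exact ⟨m, fun b hb => lt_of_lt_of_le (not_le.1 fun h => hmin b h hb) hm, hm⟩

namespace HasCotiltingExtensions

variable (h : HasCotiltingExtensions S T)
include h

/-- Dependence is witnessed in a finitely generated submodule. -/
theorem exists_finite_isDependentIn (x y : M) (c : Cardinal.{u}) : ∀ s : Set M,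
    Cardinal.mk s = c → IsDependentIn T x y (Submodule.span S ({x, y} ∪ s)) →
      ∃ t : Set M, t.Finite ∧ IsDependentIn T x y (Submodule.span S ({x, y} ∪ t)) := by
  induction c using WellFoundedLT.induction with
  | ind c ih =>
  intro s hs hdep
  by_cases hfin : c < Cardinal.aleph0
  · exact ⟨s, by rwa [← Cardinal.lt_aleph0_iff_set_finite, hs], hdep⟩
  by_contra hcon
  have hinf : Cardinal.aleph0 ≤ c := not_lt.1 hfin
  let J := c.ord.ToType
  have : NoMaxOrder J := Cardinal.noMaxOrder hinf
  have hJ : Cardinal.mk J = c := Cardinal.mk_ord_toType c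
  have : Nonempty J := by
    rw [← Cardinal.mk_ne_zero_iff, hJ]
    exact (Cardinal.aleph0_pos.trans_le hinf).ne'
  obtain ⟨e⟩ : Nonempty (J ≃ s) := Cardinal.eq.1 (hJ.trans hs.symm)
  let P (j : J) : Submodule S M :=
    Submodule.span S ({x, y} ∪ (fun i => (e i : M)) '' Set.Iio j)
  have hx : ∀ j, x ∈ P j := fun j => Submodule.subset_span (by simp)
  have hy : ∀ j, y ∈ P j := fun j => Submodule.subset_span (by simp)
  have hmono : ∀ j k, j ≤ k → P j ≤ P k := fun j k hjk =>
    Submodule.span_mono (Set.union_subset_union_right _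
      (Set.image_mono (Set.Iio_subset_Iio hjk)))
  let Q := Submodule.span S ({x, y} ∪ s)
  have hQ : ∀ a ∈ Q, ∃ j, a ∈ P j := by
    have hle : Q ≤ ⨆ j, P j := by
      refine Submodule.span_le.2 (Set.union_subset ?_ fun a ha => ?_)
      · rintro a (rfl | rfl)
        · exact (le_iSup P (Classical.arbitrary J)) (hx _)
        · exact (le_iSup P (Classical.arbitrary J)) (hy _)
      · obtain ⟨j, hj⟩ := exists_gt (e.symm ⟨a, ha⟩)
        exact (le_iSup P j) (Submodule.subset_span (Or.inr ⟨_, hj, by simp⟩))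
    intro a ha
    exact (Submodule.mem_iSup_of_directed P
      (directed_of_isDirected_le fun j k hjk => hmono j k hjk)).1 (hle ha)
  -- An initial segment has fewer than `c` generators, so dependence there would give a finite
  -- witness by induction. The limit of these maps contradicts dependence on `Q`.
  have hg : ∀ j, ∃ g : P j →ₗ[S] T, g ⟨x, hx j⟩ = 0 ∧ g ⟨y, hy j⟩ ≠ 0 := by
    intro j
    by_contra hj
    push Not at hj
    refine hcon (ih _ ?_ _ rfl fun f _ _ => hj f)
    refine Cardinal.mk_image_le.trans_lt ?_
    simpa only [hJ] using Cardinal.mk_Iio_lt j (by rw [hJ, Ordinal.type_toType])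
  choose g hgx hgy using hg
  classical
  have hev : ∀ (j : J) (a : Q) (ha : a.1 ∈ P j),
      (if ha : a.1 ∈ P j then g j ⟨a.1, ha⟩ else 0) = g j ⟨a.1, ha⟩ := fun j a ha => dif_pos ha
  obtain ⟨G, hGy, hG⟩ := h.exists_limit (M := Q) J
    (fun j a => if ha : a.1 ∈ P j then g j ⟨a.1, ha⟩ else 0)
    (fun a b => by
      obtain ⟨i, hi⟩ := hQ a a.2
      obtain ⟨j, hj⟩ := hQ b b.2
      refine ⟨max i j, fun k hk => ?_⟩
      have ha := hmono _ k (le_of_max_le_left hk) hi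
      have hb := hmono _ k (le_of_max_le_right hk) hj
      rw [hev k a ha, hev k b hb, hev k (a + b) (add_mem ha hb), ← map_add]
      rfl)
    (fun c a => by
      obtain ⟨i, hi⟩ := hQ a a.2
      refine ⟨i, fun k hk => ?_⟩
      have ha := hmono _ k hk hi
      rw [hev k a ha, hev k (c • a) (Submodule.smul_mem _ c ha), ← map_smul]
      rfl)
    ⟨y, Submodule.subset_span (by simp)⟩ (fun j => by rw [hev j _ (hy j)]; exact hgy j)
  exact hGy (hdep G (Submodule.subset_span (by simp)) _
    (hG _ ⟨Classical.arbitrary J, fun k _ => by rw [hev k _ (hx k)]; exact hgx k⟩))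

/-- Quotients cogenerated by `T` are closed under unions of chains of kernels. -/
theorem isCogeneratedBy_quotient_sSup (c : Set (Submodule S M)) (hc : IsChain (· ≤ ·) c)
    (hne : c.Nonempty) (hT : ∀ P ∈ c, IsCogeneratedBy S T (M ⧸ P)) :
    IsCogeneratedBy S T (M ⧸ sSup c) := by
  classical
  let := hc.linearOrder
  by_cases hmax : ∃ P : c, ∀ Q : c, Q ≤ P
  · obtain ⟨P, hP⟩ := hmax
    have : sSup c = P := le_antisymm (sSup_le fun Q hQ => hP ⟨Q, hQ⟩) (le_sSup P.2)
    rw [this]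
    exact hT P P.2
  · push Not at hmax
    obtain ⟨A, hA, hcof⟩ := exists_wellFounded_cofinal (α := c)
    have : Nonempty A := by
      obtain ⟨P, hP⟩ := hne
      obtain ⟨b, hb, -⟩ := hcof ⟨P, hP⟩
      exact ⟨⟨b, hb⟩⟩
    have : NoMaxOrder A := ⟨fun a => by
      obtain ⟨Q, hQ⟩ := hmax a
      obtain ⟨b, hb, hQb⟩ := hcof Q
      exact ⟨⟨b, hb⟩, show a.1 < b from lt_of_lt_of_le hQ hQb⟩⟩
    refine IsCogeneratedBy.quotient_iff.2 fun m hm => ?_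
    have hg : ∀ a : A, ∃ g : M →ₗ[S] T, a.1.1 ≤ LinearMap.ker g ∧ g m ≠ 0 := fun a =>
      IsCogeneratedBy.quotient_iff.1 (hT _ a.1.2) m fun hma => hm (le_sSup a.1.2 hma)
    choose g hgk hgm using hg
    obtain ⟨G, hGm, hG⟩ := h.exists_limit A (fun a => g a)
      (fun a b => ⟨Classical.arbitrary A, fun k _ => map_add _ _ _⟩)
      (fun s a => ⟨Classical.arbitrary A, fun k _ => map_smul _ _ _⟩) m hgm
    refine ⟨G, sSup_le fun P hP x hx => ?_, hGm⟩
    obtain ⟨b, hb, hPb⟩ := hcof ⟨P, hP⟩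
    exact hG x ⟨⟨b, hb⟩, fun k hk => hgk k ((show b ≤ k.1 from hk) (hPb hx))⟩

/-- A map from a module cogenerated by `T` factors through a quotient which is cogenerated by `T`
and cannot be replaced by a smaller one. -/
theorem exists_maximal_factorization {X : Type u} [AddCommGroup X] [Module S X]
    (hX : IsCogeneratedBy S T X) (f : X →ₗ[S] M) :
    ∃ P : Submodule S X, P ≤ LinearMap.ker f ∧ IsCogeneratedBy S T (X ⧸ P) ∧
      ∀ x, x ∉ P → ∃ y, (∀ g : X →ₗ[S] T, P ≤ LinearMap.ker g → g x = 0 → g y = 0) ∧ f y ≠ 0 := by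
  obtain ⟨P, -, hP⟩ := zorn_le_nonempty₀
    {P : Submodule S X | P ≤ LinearMap.ker f ∧ IsCogeneratedBy S T (X ⧸ P)}
    (fun c hcs hc P hP => ⟨sSup c, ⟨sSup_le fun Q hQ => (hcs hQ).1,
      h.isCogeneratedBy_quotient_sSup c hc ⟨P, hP⟩ fun Q hQ => (hcs hQ).2⟩,
      fun Q hQ => le_sSup hQ⟩)
    ⊥ ⟨bot_le, hX.of_injective (Submodule.quotEquivOfEqBot ⊥ rfl).toLinearMap
      (LinearEquiv.injective _)⟩
  refine ⟨P, hP.prop.1, hP.prop.2, fun x hx => ?_⟩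
  by_contra hcon
  push Not at hcon
  -- The least submodule containing `P` and `x` with cogenerated quotient; lying in the kernel of
  -- `f`, it would contradict maximality of `P`.
  let P' : Submodule S X :=
    ⨅ g : {g : X →ₗ[S] T // P ≤ LinearMap.ker g ∧ g x = 0}, LinearMap.ker g.1
  have hmem : ∀ y, y ∈ P' ↔ ∀ g : X →ₗ[S] T, P ≤ LinearMap.ker g → g x = 0 → g y = 0 := by
    simp [P']
  have hPP' : P ≤ P' := fun y hy => (hmem y).2 fun g hg _ => hg hy
  refine hx (hP.le_of_ge ⟨fun y hy => hcon y ((hmem y).1 hy), ?_⟩ hPP'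
    ((hmem x).2 fun g _ hg => hg))
  refine IsCogeneratedBy.quotient_iff.2 fun m hm => ?_
  rw [hmem] at hm
  push Not at hm
  obtain ⟨g, hg, hgx, hgm⟩ := hm
  exact ⟨g, fun y hy => (hmem y).1 hy g hg hgx, hgm⟩

/-- If every submodule of the kernel of `f` with quotient cogenerated by `T` vanishes, then the
size of the source of `f` is bounded in terms of its target. -/
theorem exists_injective_of_detects {X : Type u} [AddCommGroup X] [Module S X]
    (hX : IsCogeneratedBy S T X) (f : X →ₗ[S] M)
    (hf : ∀ x, x ≠ 0 → ∃ y, (∀ g : X →ₗ[S] T, g x = 0 → g y = 0) ∧ f y ≠ 0) :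
    ∃ e : X → Submodule S (ℕ →₀ S) × (ℕ →₀ S) × (ℕ →₀ S) → M, Function.Injective e := by
  classical
  -- `ψ` is a countably generated module with two marked elements; `D ψ` collects the images in `X`
  -- of the first.
  let D (ψ : Submodule S (ℕ →₀ S) × (ℕ →₀ S) × (ℕ →₀ S)) : AddSubgroup X :=
    { carrier := {x | ∃ g : (ℕ →₀ S) →ₗ[S] X, ψ.1 ≤ LinearMap.ker g ∧ g ψ.2.1 = x}
      zero_mem' := ⟨0, by simp, rfl⟩
      add_mem' := by
        rintro _ _ ⟨g, hg, rfl⟩ ⟨g', hg', rfl⟩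
        exact ⟨g + g', fun z hz => by simp [LinearMap.mem_ker.1 (hg hz),
          LinearMap.mem_ker.1 (hg' hz)], rfl⟩
      neg_mem' := by
        rintro _ ⟨g, hg, rfl⟩
        exact ⟨-g, fun z hz => by simp [LinearMap.mem_ker.1 (hg hz)], rfl⟩ }
  let r ψ (x : X) : X := Quotient.out (QuotientAddGroup.mk x : X ⧸ D ψ)
  have hr : ∀ ψ x, x - r ψ x ∈ D ψ := fun ψ x => by
    rw [sub_eq_neg_add, ← QuotientAddGroup.eq]
    exact Quotient.out_eq' _
  choose g hgL hga using hr
  -- The map `g ψ x` sends the first marked element to the difference of `x` and its coset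
  -- representative; the code records `f` on the image of the second.
  refine ⟨fun x ψ => f (g ψ x ψ.2.2), fun x x' hxx' => ?_⟩
  by_contra hne
  obtain ⟨y, hy, hfy⟩ := hf (x - x') (sub_ne_zero.2 hne)
  obtain ⟨t, ht, hdep⟩ := h.exists_finite_isDependentIn (T := T) (x - x') y _ Set.univ rfl
    (fun k hx hy' hk => by
      have htop : ∀ z, z ∈ Submodule.span S ({x - x', y} ∪ Set.univ) := fun z =>
        Submodule.subset_span (by simp)
      exact hy (k ∘ₗ LinearMap.codRestrict _ LinearMap.id htop) hk)
  have hcount : ({x - x', y} ∪ t : Set X).Countable :=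
    ((Set.toFinite _).union ht).countable
  obtain ⟨v, hv⟩ := hcount.exists_eq_range ⟨y, by simp⟩
  let l := Finsupp.linearCombination S v
  have hl : LinearMap.range l = Submodule.span S ({x - x', y} ∪ t) := by
    rw [hv]; exact Finsupp.range_linearCombination S
  rw [← hl] at hdep
  have hxl : x - x' ∈ LinearMap.range l := by rw [hl]; exact Submodule.subset_span (by simp)
  have hyl : y ∈ LinearMap.range l := by rw [hl]; exact Submodule.subset_span (by simp)
  obtain ⟨a, ha⟩ := hxl
  obtain ⟨b, hb⟩ := hyl
  let ψ : Submodule S (ℕ →₀ S) × (ℕ →₀ S) × (ℕ →₀ S) := (LinearMap.ker l, a, b)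
  have hgood : ∀ k : (ℕ →₀ S) →ₗ[S] T, LinearMap.ker l ≤ LinearMap.ker k → k a = 0 → k b = 0 := by
    intro k hk hka
    have hkl : ∀ z, ((LinearMap.ker l).liftQ k hk ∘ₗ l.quotKerEquivRange.symm.toLinearMap)
        ⟨l z, z, rfl⟩ = k z := by
      intro z
      have h3 : l.quotKerEquivRange.symm ⟨l z, z, rfl⟩ = (LinearMap.ker l).mkQ z := by
        rw [LinearEquiv.symm_apply_eq]; rfl
      simp [h3]
    have h1 := hdep ((LinearMap.ker l).liftQ k hk ∘ₗ l.quotKerEquivRange.symm.toLinearMap)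
      ⟨a, ha⟩ ⟨b, hb⟩
    simp only [← ha, ← hb, hkl] at h1
    exact h1 hka
  have hrr : r ψ x = r ψ x' := by
    have : (QuotientAddGroup.mk x : X ⧸ D ψ) = QuotientAddGroup.mk x' := by
      rw [eq_comm, QuotientAddGroup.eq, ← sub_eq_neg_add]
      exact ⟨l, le_rfl, ha⟩
    simp only [r, this]
  -- The representatives cancel, so this map kills `a`; dependence then makes it kill `b`, as `T`
  -- separates the points of `X`.
  have hz : (g ψ x - g ψ x' - l) b = 0 := by
    by_contra hne'
    obtain ⟨k, hk⟩ := hX _ hne'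
    refine hk (hgood (k ∘ₗ (g ψ x - g ψ x' - l)) (fun z hz => ?_) ?_)
    · have h1 := LinearMap.mem_ker.1 (hgL ψ x hz)
      have h2 := LinearMap.mem_ker.1 (hgL ψ x' hz)
      have h3 := LinearMap.mem_ker.1 hz
      simp [h1, h2, h3]
    · have h1 : g ψ x a = x - r ψ x := hga ψ x
      have h2 : g ψ x' a = x' - r ψ x' := hga ψ x'
      simp only [LinearMap.comp_apply, LinearMap.sub_apply, h1, h2, ha, hrr]
      rw [show x - r ψ x' - (x' - r ψ x') - (x - x') = 0 by abel, map_zero]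
  have hfz : f (g ψ x b) = f (g ψ x' b) := congrFun hxx' ψ
  apply hfy
  rw [LinearMap.sub_apply, LinearMap.sub_apply, sub_eq_zero] at hz
  rw [← hb, ← hz, map_sub, hfz, sub_self]

/-- The modules cogenerated by `T` are precovering. -/
theorem exists_precover (M : Type u) [AddCommGroup M] [Module S M] :
    ∃ (W : Type u) (_ : AddCommGroup W) (_ : Module S W) (p : W →ₗ[S] M),
      IsCogeneratedBy S T W ∧ ∀ (X : Type u) [AddCommGroup X] [Module S X],
        IsCogeneratedBy S T X → ∀ f : X →ₗ[S] M, ∃ k : X →ₗ[S] W, p ∘ₗ k = f := by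
  classical
  let Q := Submodule S (ℕ →₀ S) × (ℕ →₀ S) × (ℕ →₀ S) → M
  -- Module structures on subsets of `Q` suffice, which keeps the index set small.
  let Idx : Type u := Σ (P : Set Q) (_ : AddCommGroup P) (_ : Module S P),
    {f : P →ₗ[S] M // IsCogeneratedBy S T P}
  let P (i : Idx) : Type u := i.1
  let _ (i : Idx) : AddCommGroup (P i) := i.2.1
  let _ (i : Idx) : Module S (P i) := i.2.2.1
  let φ (i : Idx) : P i →ₗ[S] M := i.2.2.2.1
  have hP (i : Idx) : IsCogeneratedBy S T (P i) := i.2.2.2.2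
  refine ⟨DirectSum Idx P, inferInstance, inferInstance, DirectSum.toModule S Idx M φ, ?_, ?_⟩
  · refine IsCogeneratedBy.of_separating hP fun m hm => ?_
    by_contra hcon
    push Not at hcon
    exact hm (DFinsupp.ext fun i => hcon i (DirectSum.component S Idx P i))
  · intro X _ _ hX f
    obtain ⟨K, hK, hXK, hmax⟩ := h.exists_maximal_factorization hX f
    obtain ⟨e, he⟩ := h.exists_injective_of_detects hXK (K.liftQ f hK) fun x hx => by
      obtain ⟨x, rfl⟩ := K.mkQ_surjective x
      obtain ⟨y, hy, hfy⟩ := hmax x (by simpa using hx)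
      exact ⟨K.mkQ y, fun g hg => hy (g ∘ₗ K.mkQ)
        (fun z hz => by simp [(Submodule.Quotient.mk_eq_zero K).2 hz]) hg, by simpa using hfy⟩
    let E : Set.range e ≃ (X ⧸ K) := (Equiv.ofInjective e he).symm
    let a : AddCommGroup (Set.range e) := E.addCommGroup
    let m : Module S (Set.range e) := E.module S
    let L : Set.range e ≃ₗ[S] (X ⧸ K) := E.linearEquiv S
    let i : Idx := ⟨Set.range e, a, m, K.liftQ f hK ∘ₗ L.toLinearMap,
      hXK.of_injective L.toLinearMap L.injective⟩
    refine ⟨DirectSum.lof S Idx P i ∘ₗ (L.symm.toLinearMap : (X ⧸ K) →ₗ[S] P i) ∘ₗ K.mkQ, ?_⟩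
    ext x
    refine (DirectSum.toModule_lof S (φ := φ) i _).trans ?_
    change K.liftQ f hK (L (L.symm (K.mkQ x))) = f x
    simp

end HasCotiltingExtensions

end Elementary

/-! ### Vanishing of `Ext¹` as an extension property. -/

section ExtVanishing

variable {C : Type u} [Category.{v} C] [Abelian C] [HasExt.{w} C]

theorem exists_extension_of_subsingleton_ext {S : ShortComplex C} (hS : S.ShortExact) {V : C}
    [Subsingleton (Abelian.Ext.{w} S.X₃ V 1)] (f : S.X₁ ⟶ V) : ∃ g : S.X₂ ⟶ V, S.f ≫ g = f := by
  obtain ⟨x, hx⟩ := Abelian.Ext.contravariant_sequence_exact₁ hS V (Abelian.Ext.mk₀ f)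
    (n₁ := 1) rfl (Subsingleton.elim _ _)
  obtain ⟨g, rfl⟩ := (Abelian.Ext.mk₀_bijective _ _).2 x
  rw [Abelian.Ext.mk₀_comp_mk₀] at hx
  exact ⟨g, (Abelian.Ext.mk₀_bijective _ _).1 hx⟩

theorem subsingleton_ext_of_exists_extension [EnoughProjectives C] {A V : C}
    (h : ∀ (K P : C) (i : K ⟶ P) (p : P ⟶ A) (zero : i ≫ p = 0),
      (ShortComplex.mk i p zero).ShortExact → ∀ f : K ⟶ V, ∃ g : P ⟶ V, i ≫ g = f) :
    Subsingleton (Abelian.Ext.{w} A V 1) := by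
  let S : ShortComplex C := ShortComplex.mk (kernel.ι (Projective.π A)) (Projective.π A) (by simp)
  have hS : S.ShortExact :=
    { exact := ShortComplex.exact_kernel _
      mono_f := inferInstanceAs (Mono (kernel.ι _))
      epi_g := inferInstanceAs (Epi (Projective.π A)) }
  refine subsingleton_of_forall_eq 0 fun x => ?_
  have : Projective S.X₂ := inferInstanceAs (Projective (Projective.over A))
  obtain ⟨y, rfl⟩ := Abelian.Ext.contravariant_sequence_exact₃ hS V (n₀ := 0) (n₁ := 1) x
    (Abelian.Ext.eq_zero_of_projective _) rfl
  obtain ⟨f, rfl⟩ := (Abelian.Ext.mk₀_bijective _ _).2 y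
  obtain ⟨g, rfl⟩ := h _ _ _ _ S.zero hS f
  rw [← Abelian.Ext.mk₀_comp_mk₀]
  exact hS.extClass_comp_assoc (Abelian.Ext.mk₀ g)

theorem subsingleton_ext_of_retract_limit [EnoughProjectives C] {A V : C} {J : Type*}
    {F : Discrete J ⥤ C} (h : ∀ j, Subsingleton (Abelian.Ext.{w} A (F.obj j) 1)) {c : Cone F}
    (hc : IsLimit c) (r : Retract V c.pt) : Subsingleton (Abelian.Ext.{w} A V 1) := by
  refine subsingleton_ext_of_exists_extension fun K P i p zero hS f => ?_
  choose g hg using fun j =>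
    have := h j
    exists_extension_of_subsingleton_ext hS (V := F.obj j) (f ≫ r.i ≫ c.π.app j)
  refine ⟨hc.lift (Cone.mk P (Discrete.natTrans g)) ≫ r.r, ?_⟩
  have : i ≫ hc.lift (Cone.mk P (Discrete.natTrans g)) = f ≫ r.i := hc.hom_ext fun j => by
    simpa using hg j
  rw [reassoc_of% this, r.retract, Category.comp_id]

theorem shortExact_op_map_preadditiveYoneda {S : ShortComplex C} (hS : S.ShortExact) (T : C)
    [Subsingleton (Abelian.Ext.{w} S.X₃ T 1)] :
    (S.op.map (preadditiveYoneda.obj T)).ShortExact := by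
  have hF : PreservesFiniteLimits (preadditiveYoneda.obj T) := inferInstance
  obtain ⟨h₁, h₂⟩ := (Functor.preservesFiniteLimits_iff_forall_exact_map_and_mono
    (preadditiveYoneda.obj T)).1 hF S.op hS.op
  refine { exact := h₁, mono_f := h₂, epi_g := ?_ }
  rw [AddCommGrpCat.epi_iff_surjective]
  exact exists_extension_of_subsingleton_ext hS

end ExtVanishing

section Sub

variable {C : Type u} [Category.{v} C] [Abelian C]

attribute [local instance] Abelian.hasFiniteBiproducts

theorem sub_iff (U : ObjectProperty C) [U.IsClosedUnderFiniteProducts] (A : C) :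
    Sub U A ↔ ∃ (V : C) (i : A ⟶ V), U V ∧ Mono i := by
  constructor
  · rintro ⟨n, V, i, hV, hi⟩
    exact ⟨⨁ V, i, U.prop_of_isLimit_fan (biproduct.isLimit V) hV, hi⟩
  · rintro ⟨V, i, hV, hi⟩
    exact ⟨1, fun _ => V, i ≫ biproduct.ι (fun _ : Fin 1 => V) 0, fun _ => hV, mono_comp _ _⟩

end Sub

/-! ### From quasicotilting modules to support `τ⁻`-tilting subcategories. -/

section RightModules

variable {R : Type u} [Ring R]

theorem prod_pow (T : ModR R) (J : Type u) :
    Prod T (ModuleCat.of Rᵐᵒᵖ (J → T)) :=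
  ⟨J, ⟨Retract.ofIso (ModuleCat.piIsoPi fun _ : J => T).symm⟩⟩

theorem cogen_iff (T X : ModR R) : Cogen T X ↔ IsCogeneratedBy Rᵐᵒᵖ T X := by
  constructor
  · rintro ⟨Y, i, ⟨J, ⟨r⟩⟩, hi⟩
    have h : IsCogeneratedBy Rᵐᵒᵖ T (J → T) := .pi fun _ => .refl
    let k : X ⟶ ModuleCat.of Rᵐᵒᵖ (J → T) := i ≫ r.i ≫ (ModuleCat.piIsoPi fun _ : J => T).hom
    have hk : Mono k := inferInstance
    exact h.of_injective k.hom ((ModuleCat.mono_iff_injective k).1 hk)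
  · intro h
    refine ⟨_, ModuleCat.ofHom (LinearMap.pi fun f : X →ₗ[Rᵐᵒᵖ] T => f),
      prod_pow T (X →ₗ[Rᵐᵒᵖ] T), ?_⟩
    rw [ModuleCat.mono_iff_injective]
    refine (injective_iff_map_eq_zero _).2 fun x hx => ?_
    by_contra hne
    obtain ⟨f, hf⟩ := h x hne
    exact hf (congrFun hx f)

theorem cogen_of_mono {T X Y : ModR R} (i : X ⟶ Y) [Mono i] (h : Cogen T Y) : Cogen T X := by
  obtain ⟨Z, j, hZ, hj⟩ := h
  exact ⟨Z, i ≫ j, hZ, mono_comp _ _⟩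

theorem prod_le_cogen {T X : ModR R} (h : Prod T X) : Cogen T X := ⟨X, 𝟙 X, h, inferInstance⟩

theorem prod_self (T : ModR R) : Prod T T :=
  ⟨PUnit, ⟨Pi.lift fun _ => 𝟙 T, Pi.π _ PUnit.unit, by simp⟩⟩

/-- The objects of `F` against which all objects of `F` have vanishing `Ext¹`. -/
def ExtInjectives (F : ObjectProperty (ModR R)) : ObjectProperty (ModR R) := fun X =>
  F X ∧ ∀ A, F A → Subsingleton (Abelian.Ext.{u} A X 1)

theorem shortExact_of_range {X Y : Type u} [AddCommGroup X] [Module Rᵐᵒᵖ X] [AddCommGroup Y]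
    [Module Rᵐᵒᵖ Y] (i : X →ₗ[Rᵐᵒᵖ] Y) (hi : Function.Injective i) :
    (ShortComplex.mk (ModuleCat.ofHom i) (ModuleCat.ofHom (LinearMap.range i).mkQ)
      (by ext x; exact (Submodule.Quotient.mk_eq_zero _).2 ⟨x, rfl⟩)).ShortExact :=
  ModuleCat.shortComplex_shortExact _
    (fun _ => Submodule.Quotient.mk_eq_zero _) hi (Submodule.mkQ_surjective _)

variable {T : ModR R}

theorem IsQuasicotilting.hasCotiltingExtensions (hT : IsQuasicotilting T) :
    HasCotiltingExtensions Rᵐᵒᵖ T where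
  exists_extension N _ _ K hK f := by
    have hS : (ShortComplex.mk (ModuleCat.ofHom K.subtype) (ModuleCat.ofHom K.mkQ)
        (by ext x; exact (Submodule.Quotient.mk_eq_zero _).2 x.2)).ShortExact :=
      ModuleCat.shortComplex_shortExact _
        (fun y => by simp [Submodule.Quotient.mk_eq_zero]) K.injective_subtype K.mkQ_surjective
    have := hT.ext_injective (ModuleCat.of Rᵐᵒᵖ (N ⧸ K)) ((cogen_iff _ _).2 hK)
    obtain ⟨g, hg⟩ := exists_extension_of_subsingleton_ext hS (V := T) (ModuleCat.ofHom f)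
    exact ⟨g.hom, fun x => LinearMap.congr_fun (congrArg ModuleCat.Hom.hom hg) x⟩
  exists_embedding N _ _ hN := by
    have h : Copres T (ModuleCat.of Rᵐᵒᵖ N) := hT.cogen_eq_copres ▸ (cogen_iff _ _).2 hN
    obtain ⟨M₀, M₁, f, g, zero, ⟨J, ⟨r⟩⟩, h₁, hf, hex⟩ := h
    let P := ModuleCat.piIsoPi fun _ : J => T
    let s : M₀ ⟶ ModuleCat.of Rᵐᵒᵖ (J → T) := r.i ≫ P.hom
    let p : ModuleCat.of Rᵐᵒᵖ (J → T) ⟶ M₀ := P.inv ≫ r.r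
    let i : ModuleCat.of Rᵐᵒᵖ N ⟶ ModuleCat.of Rᵐᵒᵖ (J → T) := f ≫ s
    have hs : Mono s := inferInstance
    have hi : Mono i := inferInstance
    have hip : ∀ x, p (i x) = f x := fun x => by
      have : i ≫ p = f := by simp [i, s, p]
      exact LinearMap.congr_fun (congrArg ModuleCat.Hom.hom this) x
    refine ⟨J, i.hom, (ModuleCat.mono_iff_injective i).1 hi,
      IsCogeneratedBy.quotient_iff.2 fun m hm => ?_⟩
    by_cases hgm : g (p m) = 0
    · obtain ⟨x, hx⟩ := (ShortComplex.ShortExact.moduleCat_exact_iff_function_exact _).1 hex _ |>.1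
        hgm
      -- The projection to the complement of `M₀` in the power: it detects `m` when `g` does not.
      let k : (J → T) →ₗ[Rᵐᵒᵖ] (J → T) := LinearMap.id - s.hom ∘ₗ p.hom
      have hk : k m ≠ 0 := fun h0 => hm ⟨x, by
        have h1 : m = s (p m) := sub_eq_zero.1 h0
        have h2 : f x = p m := hx
        rw [h1, ← h2]
        rfl⟩
      obtain ⟨j, hj⟩ := Function.ne_iff.1 hk
      refine ⟨LinearMap.proj j ∘ₗ k, ?_, hj⟩
      rintro _ ⟨x, rfl⟩
      have h1 : k (i x) = 0 := sub_eq_zero.2 (by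
        change i x = s (p (i x))
        rw [hip]
        rfl)
      change k (i x) j = 0
      rw [h1]
      rfl
    · obtain ⟨k, hk⟩ := (cogen_iff _ _).1 (prod_le_cogen h₁) _ hgm
      refine ⟨k ∘ₗ g.hom ∘ₗ p.hom, ?_, hk⟩
      rintro _ ⟨x, rfl⟩
      have h2 : g (f x) = 0 := LinearMap.congr_fun (congrArg ModuleCat.Hom.hom zero) x
      change k (g (p (i x))) = 0
      rw [hip, h2, map_zero]

/-- An `Ext`-injective object of `Cogen T` embeds in a power of `T` with cokernel in `Cogen T`, so
the embedding splits. -/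
theorem IsQuasicotilting.prod_iff (hT : IsQuasicotilting T) (X : ModR R) :
    Prod T X ↔ ExtInjectives (Cogen T) X := by
  constructor
  · intro h
    refine ⟨prod_le_cogen h, fun A hA => ?_⟩
    obtain ⟨J, ⟨r⟩⟩ := h
    exact subsingleton_ext_of_retract_limit (fun _ => hT.ext_injective A hA) (limit.isLimit _) r
  · rintro ⟨hX, hext⟩
    obtain ⟨J, i, hi, hcok⟩ := hT.hasCotiltingExtensions.exists_embedding X ((cogen_iff _ _).1 hX)
    have := hext _ ((cogen_iff _ (ModuleCat.of Rᵐᵒᵖ ((J → T) ⧸ LinearMap.range i))).2 hcok)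
    obtain ⟨g, hg⟩ := exists_extension_of_subsingleton_ext (shortExact_of_range i hi) (𝟙 X)
    exact ⟨J, ⟨(Retract.mk (ModuleCat.ofHom i) g hg).trans
      (Retract.ofIso (ModuleCat.piIsoPi fun _ : J => T).symm)⟩⟩

theorem cogen_of_isLimit {J : Type} {F : Discrete J ⥤ ModR R} (h : ∀ j, Cogen T (F.obj j))
    {c : Cone F} (hc : IsLimit c) : Cogen T c.pt := by
  rw [cogen_iff]
  refine IsCogeneratedBy.of_separating (fun j => (cogen_iff _ _).1 (h j)) fun m hm => ?_
  by_contra hcon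
  push Not at hcon
  refine hm (Concrete.isLimit_ext F hc m 0 fun j => ?_)
  exact (hcon j (c.π.app j).hom).trans (map_zero (c.π.app j).hom).symm

theorem IsQuasicotilting.isClosedUnderFiniteProducts_prod (hT : IsQuasicotilting T) :
    (Prod T).IsClosedUnderFiniteProducts where
  isClosedUnderLimitsOfShape J _ :=
    { limitsOfShape_le := by
        rintro X ⟨p⟩
        have hp : ∀ j, ExtInjectives (Cogen T) (p.diag.obj j) := fun j =>
          (hT.prod_iff _).1 (p.prop_diag_obj j)
        exact (hT.prod_iff X).2 ⟨cogen_of_isLimit (fun j => (hp j).1) p.isLimit, fun A hA =>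
          subsingleton_ext_of_retract_limit (fun j => (hp j).2 A hA) p.isLimit (Retract.refl _)⟩ }

theorem IsQuasicotilting.sub_prod (hT : IsQuasicotilting T) : Sub (Prod T) = Cogen T := by
  have := hT.isClosedUnderFiniteProducts_prod
  funext X
  exact propext (sub_iff _ X)

/-- The kernel of an approximation of an injective module is `Ext`-injective. -/
theorem subsingleton_ext_kernel {F : ObjectProperty (ModR R)} {X I : ModR R} (g : X ⟶ I)
    (happ : ∀ A, F A → ∀ f : A ⟶ I, ∃ h : A ⟶ X, h ≫ g = f) {A : ModR R} (hA : F A)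
    [Subsingleton (Abelian.Ext.{u} A X 1)] :
    Subsingleton (Abelian.Ext.{u} A (kernel g) 1) := by
  refine subsingleton_ext_of_exists_extension fun K P i p zero hS f => ?_
  obtain ⟨a, ha⟩ := exists_extension_of_subsingleton_ext hS (V := X) (f ≫ kernel.ι g)
  dsimp only at ha
  have hepi : Epi p := hS.epi_g
  -- The map induced by `a` on the quotient `A` lifts to `X`; subtracting the lift moves `a` into
  -- the kernel of `g` and leaves it unchanged on `K`.
  let b : A ⟶ I := hS.exact.desc (a ≫ g) (by simp [reassoc_of% ha])
  have hb : p ≫ b = a ≫ g := hS.exact.g_desc _ _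
  obtain ⟨c, hc⟩ := happ A hA b
  refine ⟨kernel.lift g (a - p ≫ c) (by simp [hc, hb]), ?_⟩
  rw [← cancel_mono (kernel.ι g)]
  simp [ha, reassoc_of% zero]

/-- Embed the source of a `Cogen T`-precover of `I` in a power of `T` and extend by injectivity. The
result approximates all of `Cogen T`, which makes its kernel `Ext`-injective. -/
theorem IsQuasicotilting.exists_exact (hT : IsQuasicotilting T) (I : ModR R) [Injective I] :
    ∃ (U₀ U₁ : ModR R) (f : U₀ ⟶ U₁) (g : U₁ ⟶ I) (zero : f ≫ g = 0),
      Prod T U₀ ∧ Prod T U₁ ∧ Mono f ∧ (ShortComplex.mk f g zero).Exact ∧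
        IsRightApproximation (Prod T) g := by
  obtain ⟨W, _, _, p, hW, hp⟩ := hT.hasCotiltingExtensions.exists_precover I
  obtain ⟨J, i, hi, hcok⟩ := hT.hasCotiltingExtensions.exists_embedding W hW
  let U : ModR R := ModuleCat.of Rᵐᵒᵖ (J → T)
  have hU : Prod T U := prod_pow T J
  let i' : ModuleCat.of Rᵐᵒᵖ W ⟶ U := ModuleCat.ofHom i
  have : Mono i' := (ModuleCat.mono_iff_injective i').2 hi
  let g : U ⟶ I := Injective.factorThru (ModuleCat.ofHom p) i'
  have hg : i' ≫ g = ModuleCat.ofHom p := Injective.comp_factorThru _ _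
  have happ : ∀ A, Cogen T A → ∀ f : A ⟶ I, ∃ h : A ⟶ U, h ≫ g = f := by
    intro A hA f
    obtain ⟨k, hk⟩ := hp A ((cogen_iff _ _).1 hA) f.hom
    refine ⟨ModuleCat.ofHom k ≫ i', ?_⟩
    rw [Category.assoc, hg]
    ext x
    exact LinearMap.congr_fun hk x
  refine ⟨kernel g, U, kernel.ι g, g, by simp, ?_, hU, inferInstance,
    ShortComplex.exact_kernel g, hU, fun X hX f => happ X (prod_le_cogen hX) f⟩
  refine (hT.prod_iff _).2 ⟨cogen_of_mono (kernel.ι g) (prod_le_cogen hU), fun A hA => ?_⟩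
  have := ((hT.prod_iff U).1 hU).2 A hA
  exact subsingleton_ext_kernel g happ hA

theorem isLeftApproximation_pi_lift (T X : ModR R) :
    IsLeftApproximation (Prod T) (Pi.lift fun f : X ⟶ T => f) := by
  refine ⟨⟨_, ⟨Retract.refl _⟩⟩, ?_⟩
  rintro Y ⟨J, ⟨r⟩⟩ g
  refine ⟨Pi.lift (fun j => Pi.π (fun _ : X ⟶ T => T) (g ≫ r.i ≫ Pi.π _ j)) ≫ r.r, ?_⟩
  have : (Pi.lift fun f : X ⟶ T => f) ≫
      Pi.lift (fun j => Pi.π (fun _ : X ⟶ T => T) (g ≫ r.i ≫ Pi.π _ j)) = g ≫ r.i := by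
    ext1 j
    simp
  rw [reassoc_of% this, r.retract, Category.comp_id]

theorem IsQuasicotilting.isSupportTauMinusTilting_prod (hT : IsQuasicotilting T) :
    IsSupportTauMinusTilting.{u} (Prod T) where
  additive := hT.isClosedUnderFiniteProducts_prod
  ext_eq_zero A V hA hV := ((hT.prod_iff V).1 hV).2 A (hT.sub_prod ▸ hA)
  exists_exact I _ := hT.exists_exact I
  covariantlyFinite A := ⟨_, _, isLeftApproximation_pi_lift T A⟩

end RightModules

/-! ### From support `τ⁻`-tilting subcategories to quasicotilting modules. -/

section SupportTauMinusTilting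

variable {R : Type u} [Ring R]

theorem exists_injective_cogenerator (R : Type u) [Ring R] :
    ∃ E : ModR R, Injective E ∧ ∀ X : ModR R, IsCogeneratedBy Rᵐᵒᵖ E X := by
  obtain ⟨E, hE, hc⟩ := Abelian.has_injective_coseparator _ (ModuleCat.isSeparator.{u} Rᵐᵒᵖ)
  refine ⟨E, hE, fun X => (cogen_iff E X).1 ?_⟩
  have := (isCoseparator_iff_mono E).1 hc X
  exact ⟨_, Pi.lift fun f : X ⟶ E => f, ⟨X ⟶ E, ⟨Retract.refl _⟩⟩, this⟩

variable {U : ObjectProperty (ModR R)}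

/-- Morphisms from objects of `Sub U` to an injective module factor through a right
`U`-approximation. -/
theorem exists_factor_of_sub [U.IsClosedUnderFiniteProducts] {U₁ I X : ModR R} [Injective I]
    {g : U₁ ⟶ I} (hg : IsRightApproximation U g) (hX : Sub U X) (f : X ⟶ I) :
    ∃ h : X ⟶ U₁, h ≫ g = f := by
  obtain ⟨V, i, hV, hi⟩ := (sub_iff U X).1 hX
  obtain ⟨k, hk⟩ := hg.2 hV (Injective.factorThru f i)
  exact ⟨i ≫ k, by rw [Category.assoc, hk, Injective.comp_factorThru]⟩

/-- If `X` is cogenerated by objects of `Sub U`, then it lies in `Sub U`. -/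
theorem sub_of_isCogeneratedBy [U.IsClosedUnderFiniteProducts] (hU : IsCovariantlyFinite U)
    {T X : ModR R} (hT : U T) (hX : IsCogeneratedBy Rᵐᵒᵖ T X) : Sub U X := by
  obtain ⟨V, f, hV, hf⟩ := hU X
  refine (sub_iff U X).2 ⟨V, f, hV, ?_⟩
  rw [ModuleCat.mono_iff_injective]
  refine (injective_iff_map_eq_zero f.hom).2 fun x hx => ?_
  by_contra hne
  obtain ⟨g, hg⟩ := hX x hne
  obtain ⟨h, hh⟩ := hf hT (ModuleCat.ofHom g)
  refine hg ?_
  have h1 : h (f x) = g x := LinearMap.congr_fun (congrArg ModuleCat.Hom.hom hh) x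
  rw [← h1]
  exact (congrArg h.hom hx).trans (map_zero h.hom)

theorem copres_le_cogen {T X : ModR R} (h : Copres T X) : Cogen T X := by
  obtain ⟨M₀, _, f, _, _, h₀, _, hf, _⟩ := h
  exact ⟨M₀, f, h₀, hf⟩

/-- Every support `τ⁻`-tilting subcategory is equivalent to one of the form `Prod T`. -/
theorem IsSupportTauMinusTilting.exists_quasicotilting (hU : IsSupportTauMinusTilting.{u} U) :
    ∃ T : ModR R, IsQuasicotilting T ∧ Cogen T = Sub U := by
  have := hU.additive
  obtain ⟨E, hE, hcog⟩ := exists_injective_cogenerator R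
  obtain ⟨U₀, U₁, f₀, g, zero, hU₀, hU₁, hf₀, hex, hg⟩ := hU.exists_exact E hE
  -- `U₁` alone cogenerates `Sub U`; the summand `U₀` lets maps `X ⟶ U₀` extend along the
  -- approximation `f` below.
  let T : ModR R := U₀ ⊞ U₁
  have hT : U T := U.prop_of_isLimit (BinaryBiproduct.isLimit U₀ U₁) (by
    rintro ⟨_ | _⟩
    exacts [hU₀, hU₁])
  have hcogT : Cogen T U₁ := cogen_of_mono (biprod.inr : U₁ ⟶ T) (prod_le_cogen (prod_self T))
  have hsub : Cogen T = Sub U := by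
    funext X
    refine propext ⟨fun h => sub_of_isCogeneratedBy hU.covariantlyFinite hT ((cogen_iff T X).1 h),
      fun h => (cogen_iff T X).2 ?_⟩
    refine IsCogeneratedBy.of_separating (fun _ : Unit => (cogen_iff T U₁).1 hcogT) fun x hx => ?_
    obtain ⟨e, he⟩ := hcog X x hx
    obtain ⟨k, hk⟩ := exists_factor_of_sub hg h (ModuleCat.ofHom e)
    refine ⟨(), k.hom, fun h0 => he ?_⟩
    have h1 : g (k x) = e x := LinearMap.congr_fun (congrArg ModuleCat.Hom.hom hk) x
    rw [← h1]
    exact (congrArg g.hom h0).trans (map_zero g.hom)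
  have hext : ∀ X, Cogen T X → Subsingleton (Abelian.Ext.{u} X T 1) := fun X hX =>
    hU.ext_eq_zero X T (hsub ▸ hX) hT
  refine ⟨T, ⟨?_, ?_, hext⟩, hsub⟩
  · funext X
    refine propext ⟨fun hX => ?_, copres_le_cogen⟩
    let T₀ : ModR R := ∏ᶜ fun _ : X ⟶ T => T
    let f : X ⟶ T₀ := Pi.lift fun f : X ⟶ T => f
    have hf : IsLeftApproximation (Prod T) f := isLeftApproximation_pi_lift T X
    have hmono : Mono f := by
      obtain ⟨Y, i, hY, hi⟩ := hX
      obtain ⟨k, hk⟩ := hf.2 hY i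
      exact mono_of_mono_fac hk
    have hT₀ : Sub U T₀ := hsub ▸ prod_le_cogen hf.1
    have hL : Cogen T (cokernel f) := by
      rw [cogen_iff]
      refine IsCogeneratedBy.of_separating (fun _ : Unit => (cogen_iff T U₁).1 hcogT)
        fun l hl => ?_
      obtain ⟨e, he⟩ := hcog (cokernel f) l hl
      let e' : cokernel f ⟶ E := ModuleCat.ofHom e
      obtain ⟨k, hk⟩ := exists_factor_of_sub hg hT₀ (cokernel.π f ≫ e')
      let a : X ⟶ U₀ := hex.lift (f ≫ k) (by simp [hk])
      have ha : a ≫ f₀ = f ≫ k := hex.lift_f _ _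
      obtain ⟨b, hb⟩ := hf.2 (prod_self T) (a ≫ biprod.inl)
      -- The correction kills `X` without changing the composite with `g`, because `f₀ ≫ g = 0`.
      let c : T₀ ⟶ U₁ := k - b ≫ biprod.fst ≫ f₀
      have hc : f ≫ c = 0 := by
        simp [c, reassoc_of% hb, ha]
      have hcd : cokernel.desc f c hc ≫ g = e' := by
        rw [← cancel_epi (cokernel.π f)]
        simp [c, hk, zero]
      refine ⟨(), (cokernel.desc f c hc).hom, fun h0 => he ?_⟩
      have h1 : g (cokernel.desc f c hc l) = e l :=
        LinearMap.congr_fun (congrArg ModuleCat.Hom.hom hcd) l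
      rw [← h1]
      exact (congrArg g.hom h0).trans (map_zero g.hom)
    obtain ⟨Y, j, hY, hj⟩ := hL
    refine ⟨T₀, Y, f, cokernel.π f ≫ j, by simp, hf.1, hY, hmono, ?_⟩
    exact (ShortComplex.exact_iff_of_epi_of_isIso_of_mono
      (S₁ := ShortComplex.mk f (cokernel.π f) (by simp))
      (S₂ := ShortComplex.mk f (cokernel.π f ≫ j) (by simp))
      { τ₁ := 𝟙 _, τ₂ := 𝟙 _, τ₃ := j }).1 (ShortComplex.exact_cokernel f)
  · intro S hS _ _ h₃
    have := hext _ h₃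
    exact shortExact_op_map_preadditiveYoneda hS T

end SupportTauMinusTilting

theorem prod_eq_of_cogen_eq {R : Type u} [Ring R] {T T' : ModR R} (hT : IsQuasicotilting T)
    (hT' : IsQuasicotilting T') (h : Cogen T = Cogen T') : Prod T = Prod T' := by
  funext X
  exact propext ((hT.prod_iff X).trans (h ▸ (hT'.prod_iff X).symm))

end TauTilting

theorem mainTheorem6 (R : Type u) [Ring R] :
    ∃ Φ : Quotient (TauTilting.supportTauMinusTiltingSetoid R) ≃
        Quotient (TauTilting.quasicotiltingSetoid R),
      ∀ T : TauTilting.Quasicotilting R,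
        ∃ h : TauTilting.IsSupportTauMinusTilting.{u} (TauTilting.Prod T.1),
          Φ (Quotient.mk (TauTilting.supportTauMinusTiltingSetoid R) ⟨TauTilting.Prod T.1, h⟩) =
            Quotient.mk (TauTilting.quasicotiltingSetoid R) T := by
  let Ψ : Quotient (TauTilting.quasicotiltingSetoid R) →
      Quotient (TauTilting.supportTauMinusTiltingSetoid R) :=
    Quotient.map (fun T => ⟨TauTilting.Prod T.1, T.2.isSupportTauMinusTilting_prod⟩)
      fun _ _ h => congrArg TauTilting.Sub h
  have hΨ : Function.Bijective Ψ := by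
    constructor
    · rintro ⟨T⟩ ⟨T'⟩ h
      have h' : TauTilting.Sub (TauTilting.Prod T.1) = TauTilting.Sub (TauTilting.Prod T'.1) :=
        Quotient.exact h
      rw [T.2.sub_prod, T'.2.sub_prod] at h'
      exact Quotient.sound (TauTilting.prod_eq_of_cogen_eq T.2 T'.2 h')
    · rintro ⟨U, hU⟩
      obtain ⟨T, hT, hTU⟩ := hU.exists_quasicotilting
      refine ⟨Quotient.mk _ ⟨T, hT⟩, Quotient.sound ?_⟩
      exact hT.sub_prod.trans hTU
  refine ⟨(Equiv.ofBijective Ψ hΨ).symm, fun T => ⟨T.2.isSupportTauMinusTilting_prod, ?_⟩⟩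
  rw [Equiv.symm_apply_eq]
  rfl
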